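/- Let $(W,S)$ be an irreducible Coxeter system of finite rank (i.e. $S$ is finite and the Coxeter diagram is connected and non-empty), with length function $\ell$ and Coxeter matrix $(m_{s,s'})_{s,s'\in S}$, where $m_{s,s'}$ is the order of $ss'$ in $W$. Suppose that $W$ is infinite, that the Coxeter diagram is simply laced (i.e. $m_{s,s'}\in\{2,3\}$ for all $s\neq s'$ in $S$), and that $(W,S)$ is not affine (i.e. it is not the case that the symmetric matrix $\bigl(-\cos(\pi/m_{s,s'})\bigr)_{s,s'\in S}$ is positive semidefinite but not positive definite). Let $J\subsetneq S$ be a proper subset, let $W_J=\langle J\rangle$, and let $$W^J=\{w\in W:\ \ell(w)\le \ell(wv)\ \text{for all } v\in W_J\}$$ be the set of minimal-length elements of the left cosets of $W_J$ in $W$. Then $W^J$ has exponential growth, that is, $$\limsup_{k\to\infty}\ \bigl(\#\{w\in W^J:\ \ell(w)\le k\}\bigr)^{1/k}>1 .$$ -/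

import Mathlib

open Filter
open scoped ENNReal

noncomputable section

namespace CoxeterMatrix

variable {B : Type*} (M : CoxeterMatrix B)

/-- The Coxeter diagram, as a graph: two distinct nodes are joined by an edge when the corresponding
entry of the Coxeter matrix is not `2` (that is, it is at least `3`, or infinite, which Mathlib
encodes as `0`). -/
def diagram : SimpleGraph B where
  Adj i j := i ≠ j ∧ M i j ≠ 2
  symm := ⟨fun i j h => ⟨h.1.symm, by rw [M.symmetric j i]; exact h.2⟩⟩
  loopless := ⟨fun _ h => h.1 rfl⟩

/-- A Coxeter matrix is irreducible when its diagram is connected (and nonempty). -/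
def IsIrreducible : Prop := M.diagram.Connected

/-- The diagram is simply laced: off-diagonal entries of the Coxeter matrix are `2` or `3`. -/
def IsSimplyLaced : Prop := ∀ i j : B, i ≠ j → M i j = 2 ∨ M i j = 3

/-- The Gram matrix `-cos (π / m i j)` of the canonical bilinear form of the geometric
representation, in the basis of simple roots. An infinite entry is encoded as `M i j = 0`;
then `π / 0 = 0` in Lean and the value is `-cos 0 = -1`, as it should be. -/
def gram : Matrix B B ℝ := Matrix.of fun i j => -Real.cos (Real.pi / (M i j : ℝ))

/-- An (irreducible) Coxeter matrix is of affine type when the canonical bilinear form is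
positive semidefinite but not positive definite. -/
def IsAffine : Prop := M.IsIrreducible ∧ M.gram.PosSemidef ∧ ¬ M.gram.PosDef

end CoxeterMatrix

namespace CoxeterSystem

variable {B : Type*} {W : Type*} [Group W] {M : CoxeterMatrix B} (cs : CoxeterSystem M W)

/-- The standard parabolic subgroup `W_J`, generated by the simple reflections indexed by `J`. -/
def parabolic (J : Set B) : Subgroup W := Subgroup.closure (cs.simple '' J)

/-- The set `W^J` of elements `w` that have minimal length in their left coset `w W_J`. -/
def minCosetReps (J : Set B) : Set W :=
  {w | ∀ v ∈ cs.parabolic J, cs.length w ≤ cs.length (w * v)}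

/-- The growth function of a subset `F`: the number of `f ∈ F` with `ℓ(f) ≤ k`. -/
def growth (F : Set W) (k : ℕ) : ℕ := {f | f ∈ F ∧ cs.length f ≤ k}.ncard

/-- In finite rank, the set counted by `growth` is finite. -/
theorem growth_set_finite [Finite B] (F : Set W) (k : ℕ) :
    {f | f ∈ F ∧ cs.length f ≤ k}.Finite := by
  refine ((List.finite_length_le B k).image cs.wordProd).subset ?_
  rintro f ⟨-, hf⟩
  obtain ⟨ω, hω, rfl⟩ := cs.exists_isReduced f
  exact ⟨ω, by simpa [hω.eq] using hf, rfl⟩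

/-- The exponential growth rate `ω(F)`, the upper limit of the `k`-th roots of the growth
function, taken in `[0, ∞]` so that it always exists. -/
def growthRate (F : Set W) : ℝ≥0∞ :=
  limsup (fun k : ℕ => (cs.growth F k : ℝ≥0∞) ^ (1 / (k : ℝ))) atTop

/-- `F` has exponential growth. -/
def HasExponentialGrowth (F : Set W) : Prop := 1 < cs.growthRate F

end CoxeterSystem

end

/-! Let W act on the root lattice ℤ^B; as the diagram is simply laced, everything is integral. The
coordinate at `s` is a fundamental weight, fixed by W_J when `s ∉ J`, so distinct translates of it
come from distinct cosets of W_J. It suffices to find exponentially many translates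
(`card_le_growth_minCosetReps`).

They come from ping-pong: if three roots have pairwise products at most -2, the signs of a
translated weight on these roots reveal the leftmost letter of an alternating word in the three
reflections (`hasExponentialGrowth_of_three_roots`).

To find such roots, suppose that all products of roots with simple roots lie in [-2, 2]. The roots
then induce finitely many functionals, whose sum of squares is an invariant form, proportional to
the Cartan form by irreducibility. So the Gram matrix is positive semidefinite, hence positive
definite as W is not affine, hence W is finite, a contradiction. So some positive root has product
at most -3 with a simple root; reflecting it in that simple root and a neighbouring one gives the
triple (`exists_three_roots`). By connectedness the triple can be moved so that the weight at `s` is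
nonnegative on it and not identically zero (`exists_rootAction_pos`). -/

noncomputable section

/-! ### The Cartan form and its reflections -/

namespace CoxeterMatrix

variable {B : Type*} [Fintype B] [DecidableEq B] (M : CoxeterMatrix B)

/-- The integral Cartan matrix of a simply laced Coxeter matrix: `2` on the diagonal, `-1` at edges
of the diagram, and `0` elsewhere. -/
def cartan : Matrix B B ℤ :=
  Matrix.of fun i j => if i = j then 2 else if M i j = 2 then 0 else -1

omit [Fintype B] in
theorem cartan_self (i : B) : M.cartan i i = 2 := by simp [cartan]

omit [Fintype B] in
theorem cartan_symm (i j : B) : M.cartan i j = M.cartan j i := by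
  simp [cartan, M.symmetric i j, eq_comm]

omit [Fintype B] in
theorem cartan_of_eq_two {i j : B} (h : M i j = 2) : M.cartan i j = 0 := by
  have hij : i ≠ j := by rintro rfl; simp at h
  simp [cartan, hij, h]

omit [Fintype B] in
theorem cartan_of_eq_three {i j : B} (h : M i j = 3) : M.cartan i j = -1 := by
  have hij : i ≠ j := by rintro rfl; simp at h
  simp [cartan, hij, h]

omit [Fintype B] in
theorem cartan_eq_neg_one_iff (i j : B) : M.cartan i j = -1 ↔ M.diagram.Adj i j := by
  by_cases h : i = j <;> by_cases h' : M i j = 2 <;> simp [cartan, diagram, h, h']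

omit [Fintype B] in
theorem cartan_eq_zero {i j : B} (h : i ≠ j) (h' : ¬ M.diagram.Adj i j) : M.cartan i j = 0 := by
  simp only [diagram, not_and, not_not] at h'
  simp [cartan, h, h' h]

omit [Fintype B] in
theorem cartan_nonpos {i j : B} (h : i ≠ j) : M.cartan i j ≤ 0 := by
  by_cases h' : M i j = 2 <;> simp [cartan, h, h']

/-- The bilinear form on the root lattice `ℤ^B` given by the Cartan matrix. -/
def form : LinearMap.BilinForm ℤ (B → ℤ) := Matrix.toBilin' M.cartan

/-- The simple root indexed by `i`, as an element of the root lattice. -/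
abbrev simpleRoot (i : B) : B → ℤ := Pi.single i 1

theorem form_simpleRoot_simpleRoot (i j : B) :
    M.form (simpleRoot i) (simpleRoot j) = M.cartan i j := by
  simp [form, simpleRoot, Matrix.toBilin'_single]

theorem form_simpleRoot_self (i : B) : M.form (simpleRoot i) (simpleRoot i) = 2 := by
  rw [form_simpleRoot_simpleRoot, cartan_self]

theorem form_apply (u v : B → ℤ) : M.form u v = ∑ i, ∑ j, u i * M.cartan i j * v j := by
  simp [form, Matrix.toBilin'_apply]

theorem form_symm (u v : B → ℤ) : M.form u v = M.form v u := by
  rw [form_apply, form_apply, Finset.sum_comm]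
  refine Finset.sum_congr rfl fun i _ => Finset.sum_congr rfl fun j _ => ?_
  rw [M.cartan_symm i j]; ring

theorem form_simpleRoot_right (v : B → ℤ) (j : B) :
    M.form v (simpleRoot j) = ∑ i, v i * M.cartan i j := by
  rw [form_apply]
  refine Finset.sum_congr rfl fun i _ => ?_
  rw [Finset.sum_eq_single j] <;> simp +contextual

/-- The map `v ↦ v - (v, r) r`; it is the reflection in `r` when `(r, r) = 2`. -/
def reflectionMap (r : B → ℤ) : Module.End ℤ (B → ℤ) :=
  LinearMap.id - (M.form.flip r).smulRight r

theorem reflectionMap_apply (r v : B → ℤ) : M.reflectionMap r v = v - M.form v r • r := rfl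

theorem reflectionMap_involutive {r : B → ℤ} (hr : M.form r r = 2) (v : B → ℤ) :
    M.reflectionMap r (M.reflectionMap r v) = v := by
  simp only [reflectionMap_apply, map_sub, map_smul, hr]
  module

theorem form_reflectionMap {r : B → ℤ} (hr : M.form r r = 2) (u v : B → ℤ) :
    M.form (M.reflectionMap r u) (M.reflectionMap r v) = M.form u v := by
  simp only [reflectionMap_apply, map_sub, map_smul, LinearMap.sub_apply, LinearMap.smul_apply, hr,
    smul_eq_mul, M.form_symm r v]
  ring

theorem reflectionMap_simpleRoot_apply_of_ne {i j : B} (h : j ≠ i) (v : B → ℤ) :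
    M.reflectionMap (simpleRoot i) v j = v j := by
  simp [reflectionMap_apply, h]

variable {M}

theorem IsSimplyLaced.isLiftable (hsl : M.IsSimplyLaced) :
    M.IsLiftable fun i => M.reflectionMap (simpleRoot i) := by
  intro i j
  have hi := M.form_simpleRoot_self i
  have hj := M.form_simpleRoot_self j
  by_cases hij : i = j
  · subst hij
    rw [M.diagonal, pow_one]
    ext1 v
    ext1
    simp [reflectionMap_involutive M hi]
  have hc := M.form_simpleRoot_simpleRoot i j
  have hc' := M.form_simpleRoot_simpleRoot j i
  rcases hsl i j hij with h | h
  · rw [M.cartan_symm, M.cartan_of_eq_two h] at hc'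
    rw [M.cartan_of_eq_two h] at hc
    refine LinearMap.ext fun v => ?_
    simp only [h, pow_succ, pow_zero, one_mul, Module.End.mul_apply, Module.End.one_apply,
      reflectionMap_apply, map_sub, map_smul, hi, hj, hc, hc']
    module
  · rw [M.cartan_symm, M.cartan_of_eq_three h] at hc'
    rw [M.cartan_of_eq_three h] at hc
    refine LinearMap.ext fun v => ?_
    simp only [h, pow_succ, pow_zero, one_mul, Module.End.mul_apply, Module.End.one_apply,
      reflectionMap_apply, map_sub, map_smul, hi, hj, hc, hc']
    module

end CoxeterMatrix

/-! ### The geometric representation, roots and Tits' lemma -/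

namespace CoxeterSystem

open CoxeterMatrix

variable {B : Type*} [Fintype B] [DecidableEq B] {W : Type*} [Group W] {M : CoxeterMatrix B}
  (cs : CoxeterSystem M W) (hsl : M.IsSimplyLaced)

/-- The geometric representation on the root lattice, in the simply laced case. -/
def rootAction : W →* Module.End ℤ (B → ℤ) := cs.lift ⟨_, hsl.isLiftable⟩

theorem rootAction_simple (i : B) :
    cs.rootAction hsl (cs.simple i) = M.reflectionMap (simpleRoot i) :=
  cs.lift_apply_simple hsl.isLiftable i

theorem rootAction_mul_apply (u w : W) (v : B → ℤ) :
    cs.rootAction hsl (u * w) v = cs.rootAction hsl u (cs.rootAction hsl w v) := by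
  rw [map_mul, Module.End.mul_apply]

theorem rootAction_inv_apply (w : W) (v : B → ℤ) :
    cs.rootAction hsl w⁻¹ (cs.rootAction hsl w v) = v := by
  rw [← rootAction_mul_apply, inv_mul_cancel, map_one, Module.End.one_apply]

theorem rootAction_apply_inv (w : W) (v : B → ℤ) :
    cs.rootAction hsl w (cs.rootAction hsl w⁻¹ v) = v := by
  rw [← rootAction_mul_apply, mul_inv_cancel, map_one, Module.End.one_apply]

theorem form_rootAction (w : W) (u v : B → ℤ) :
    M.form (cs.rootAction hsl w u) (cs.rootAction hsl w v) = M.form u v := by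
  induction w using cs.simple_induction_left generalizing u v with
  | one => simp
  | mul_simple_left w i ih =>
    rw [rootAction_mul_apply, rootAction_mul_apply, rootAction_simple,
      M.form_reflectionMap (M.form_simpleRoot_self i), ih]

/-- This realises the reflection in any root by an involution of W. -/
theorem rootAction_conj (w : W) (i : B) :
    cs.rootAction hsl (w * cs.simple i * w⁻¹) =
      M.reflectionMap (cs.rootAction hsl w (simpleRoot i)) := by
  refine LinearMap.ext fun v => ?_
  rw [rootAction_mul_apply, rootAction_mul_apply, rootAction_simple, M.reflectionMap_apply,
    M.reflectionMap_apply, map_sub, map_smul, rootAction_apply_inv,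
    ← cs.form_rootAction hsl w (cs.rootAction hsl w⁻¹ v), rootAction_apply_inv]

/-- The roots: the orbit of the simple roots. -/
def roots : Set (B → ℤ) := {r | ∃ w i, r = cs.rootAction hsl w (simpleRoot i)}

variable {cs hsl}

theorem simpleRoot_mem_roots (i : B) : simpleRoot i ∈ cs.roots hsl := ⟨1, i, by simp⟩

theorem rootAction_mem_roots {r : B → ℤ} (hr : r ∈ cs.roots hsl) (w : W) :
    cs.rootAction hsl w r ∈ cs.roots hsl := by
  obtain ⟨u, i, rfl⟩ := hr
  exact ⟨w * u, i, by rw [rootAction_mul_apply]⟩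

theorem form_self_of_mem_roots {r : B → ℤ} (hr : r ∈ cs.roots hsl) : M.form r r = 2 := by
  obtain ⟨u, i, rfl⟩ := hr
  rw [form_rootAction, form_simpleRoot_self]

theorem reflectionMap_mem_roots {r : B → ℤ} (hr : r ∈ cs.roots hsl) (i : B) :
    M.reflectionMap (simpleRoot i) r ∈ cs.roots hsl := by
  rw [← cs.rootAction_simple hsl]
  exact rootAction_mem_roots hr _

theorem neg_mem_roots {r : B → ℤ} (hr : r ∈ cs.roots hsl) : -r ∈ cs.roots hsl := by
  obtain ⟨u, i, rfl⟩ := hr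
  refine ⟨u * cs.simple i, i, ?_⟩
  rw [rootAction_mul_apply, rootAction_simple, reflectionMap_apply, form_simpleRoot_self, ← map_neg]
  congr 1
  module

variable (cs hsl) in
/-- Tits' lemma: `w α_i` is positive unless `i` is a right descent of `w`. -/
theorem rootAction_simpleRoot_nonneg {w : W} {i : B} (h : ¬ cs.IsRightDescent w i) :
    0 ≤ cs.rootAction hsl w (simpleRoot i) := by
  induction hn : cs.length w using Nat.strong_induction_on generalizing w i with
  | _ n ih =>
  subst hn
  by_cases hw : w = 1
  · subst hw
    simp [simpleRoot]
  obtain ⟨t, ht⟩ := cs.exists_rightDescent_of_ne_one hw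
  have hti : i ≠ t := by rintro rfl; exact h ht
  obtain ⟨v, rfl⟩ : ∃ v, w = v * cs.simple t := ⟨w * cs.simple t, by simp⟩
  have hv : ¬ cs.IsRightDescent v t := by
    have := cs.isRightDescent_iff_not_isRightDescent_mul.1 ht
    simpa using this
  have hlt := cs.isRightDescent_iff.1 ht
  rw [simple_mul_simple_cancel_right] at hlt
  rw [not_isRightDescent_iff] at h
  have hvt := ih _ (by omega) hv rfl
  have hc := M.form_simpleRoot_simpleRoot i t
  rcases hsl i t hti with hm | hm
  · rw [rootAction_mul_apply, rootAction_simple, reflectionMap_apply, hc, M.cartan_of_eq_two hm,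
      zero_smul, sub_zero]
    refine ih (cs.length v) (by omega) (fun hd => ?_) rfl
    have hcomm : cs.simple t * cs.simple i = cs.simple i * cs.simple t := by
      have := cs.simple_mul_simple_pow i t
      rw [hm, sq] at this
      have := mul_eq_one_iff_eq_inv.1 this
      simpa using this.symm
    have := cs.length_mul_le (v * cs.simple i) (cs.simple t)
    rw [length_simple, mul_assoc, ← hcomm, ← mul_assoc] at this
    unfold IsRightDescent at hd
    omega
  · have hact : M.reflectionMap (simpleRoot t) (simpleRoot i) = simpleRoot i + simpleRoot t := by
      rw [reflectionMap_apply, hc, M.cartan_of_eq_three hm]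
      module
    rw [rootAction_mul_apply, rootAction_simple, hact, map_add]
    -- If v = u s_i, the vector is u α_t. Were t a descent of u, the braid relation would give w s_i
    -- = u s_t s_i s_t, of length at most ℓ(u) + 1 instead of ℓ(u) + 3.
    by_cases hd : cs.IsRightDescent v i
    · obtain ⟨u, rfl⟩ : ∃ u, v = u * cs.simple i := ⟨v * cs.simple i, by simp⟩
      have hlu := cs.isRightDescent_iff.1 hd
      rw [simple_mul_simple_cancel_right] at hlu
      have hact' : M.reflectionMap (simpleRoot i) (simpleRoot i + simpleRoot t) = simpleRoot t := by
        rw [reflectionMap_apply, map_add, LinearMap.add_apply, form_simpleRoot_self, form_symm, hc,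
          M.cartan_of_eq_three hm]
        module
      rw [← map_add, rootAction_mul_apply, rootAction_simple, hact']
      refine ih (cs.length u) (by omega) (fun hd' => ?_) rfl
      have hbraid : cs.simple i * cs.simple t * cs.simple i =
          cs.simple t * cs.simple i * cs.simple t := by
        have := cs.simple_mul_simple_pow i t
        rw [hm, pow_succ, sq, ← mul_assoc, mul_assoc _ (cs.simple i), ← mul_assoc,
          mul_assoc _ (cs.simple t), mul_assoc, mul_eq_one_iff_eq_inv] at this
        refine mul_right_cancel (b := cs.simple t) ?_
        simpa [mul_assoc] using this
      have := cs.length_mul_le (u * cs.simple t) (cs.simple i * cs.simple t)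
      have h2 := cs.length_mul_le (cs.simple i) (cs.simple t)
      rw [length_simple, length_simple] at h2
      rw [mul_assoc, ← mul_assoc (cs.simple t), ← hbraid] at this
      simp only [mul_assoc] at this h
      unfold IsRightDescent at hd'
      simp only [mul_assoc] at hd' hlt
      omega
    · exact add_nonneg (ih _ (by omega) hd rfl) hvt

theorem rootAction_simpleRoot_nonpos {w : W} {i : B} (h : cs.IsRightDescent w i) :
    cs.rootAction hsl w (simpleRoot i) ≤ 0 := by
  have := cs.rootAction_simpleRoot_nonneg hsl (cs.isRightDescent_iff_not_isRightDescent_mul.1 h)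
  rw [rootAction_mul_apply, rootAction_simple, reflectionMap_apply, form_simpleRoot_self] at this
  have h2 : simpleRoot i - (2 : ℤ) • simpleRoot i = -simpleRoot i := by module
  rw [h2, map_neg] at this
  exact neg_nonneg.1 this

theorem nonneg_or_nonpos_of_mem_roots {r : B → ℤ} (hr : r ∈ cs.roots hsl) : 0 ≤ r ∨ r ≤ 0 := by
  obtain ⟨w, i, rfl⟩ := hr
  by_cases h : cs.IsRightDescent w i
  · exact .inr (rootAction_simpleRoot_nonpos h)
  · exact .inl (cs.rootAction_simpleRoot_nonneg hsl h)

variable (cs hsl) in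
theorem rootAction_injective : Function.Injective (cs.rootAction hsl) := by
  rw [injective_iff_map_eq_one]
  intro w hw
  by_contra hne
  obtain ⟨t, ht⟩ := cs.exists_rightDescent_of_ne_one hne
  have := rootAction_simpleRoot_nonpos (hsl := hsl) ht t
  simp [hw, simpleRoot] at this

/-- A simple reflection keeps a positive root positive, unless it is the corresponding simple
root. -/
theorem reflectionMap_nonneg {r : B → ℤ} (hr : r ∈ cs.roots hsl) (h0 : 0 ≤ r) {i : B}
    (hi : r ≠ simpleRoot i) : 0 ≤ M.reflectionMap (simpleRoot i) r := by
  refine (nonneg_or_nonpos_of_mem_roots (reflectionMap_mem_roots hr i)).resolve_right fun h => ?_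
  -- The reflection changes only coordinate `i`, so the others are both nonnegative and nonpositive;
  -- norm 2 then forces the coefficient 1.
  have hsingle : r = r i • simpleRoot i := by
    ext j
    by_cases hj : j = i
    · subst hj; simp
    · have := h j
      rw [M.reflectionMap_simpleRoot_apply_of_ne hj] at this
      have h0j := h0 j
      simp only [Pi.zero_apply] at this h0j
      simp [hj]
      omega
  have h2 := form_self_of_mem_roots hr
  rw [hsingle, LinearMap.map_smul₂, map_smul, form_simpleRoot_self, smul_eq_mul, smul_eq_mul] at h2
  have h0i := h0 i
  simp only [Pi.zero_apply] at h0i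
  have : r i = 1 := by nlinarith
  rw [this, one_smul] at hsingle
  exact hi hsingle

end CoxeterSystem

/-! ### Translates of a fundamental weight and ping-pong -/

namespace CoxeterSystem

open CoxeterMatrix

variable {B : Type*} [Fintype B] [DecidableEq B] {W : Type*} [Group W] {M : CoxeterMatrix B}
  (cs : CoxeterSystem M W) (hsl : M.IsSimplyLaced)

/-- The translate by `w` of the fundamental weight at `s`, as a function on the root lattice. -/
def weight (s : B) (w : W) (v : B → ℤ) : ℤ := cs.rootAction hsl w⁻¹ v s

theorem weight_mul (s : B) (u w : W) (v : B → ℤ) :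
    cs.weight hsl s (u * w) v = cs.weight hsl s w (cs.rootAction hsl u⁻¹ v) := by
  rw [weight, weight, mul_inv_rev, rootAction_mul_apply]

/-- The fundamental weight at `s ∉ J` is fixed by the parabolic subgroup `W_J`. -/
theorem weight_mul_of_mem_parabolic {s : B} {J : Set B} (hs : s ∉ J) {u : W}
    (hu : u ∈ cs.parabolic J) (w : W) : cs.weight hsl s (w * u) = cs.weight hsl s w := by
  have key : ∀ v, cs.rootAction hsl u v s = v s := by
    induction hu using Subgroup.closure_induction with
    | mem x hx =>
      obtain ⟨i, hi, rfl⟩ := hx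
      intro v
      rw [rootAction_simple, M.reflectionMap_simpleRoot_apply_of_ne]
      rintro rfl
      exact hs hi
    | one => simp
    | mul x y _ _ hx hy => intro v; rw [rootAction_mul_apply, hx, hy]
    | inv x _ hx => intro v; rw [← hx (cs.rootAction hsl x⁻¹ v), rootAction_apply_inv]
  funext v
  rw [weight, weight, mul_inv_rev, rootAction_mul_apply, ← key (cs.rootAction hsl u⁻¹ _),
    rootAction_apply_inv]

/-- The growth function of `W^J` is bounded below by the number of translates of a fundamental
weight. -/
theorem card_le_growth_minCosetReps {s : B} {J : Set B} (hs : s ∉ J) {ι : Type*} [Fintype ι]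
    {k : ℕ} (w : ι → W) (hk : ∀ i, cs.length (w i) ≤ k)
    (hinj : Function.Injective fun i => cs.weight hsl s (w i)) :
    Fintype.card ι ≤ cs.growth (cs.minCosetReps J) k := by
  have hmin : ∀ i, ∃ u ∈ cs.parabolic J, w i * u ∈ cs.minCosetReps J ∧
      cs.length (w i * u) ≤ cs.length (w i) := by
    intro i
    obtain ⟨u, hu⟩ := exists_minimalFor_of_wellFoundedLT (· ∈ cs.parabolic J)
      (fun u => cs.length (w i * u)) ⟨1, one_mem _⟩
    have hle : ∀ v ∈ cs.parabolic J, cs.length (w i * u) ≤ cs.length (w i * v) := fun v hv =>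
      (le_total _ _).elim id fun h => hu.2 hv h
    refine ⟨u, hu.1, fun v hv => ?_, ?_⟩
    · rw [mul_assoc]
      exact hle _ (mul_mem hu.1 hv)
    · simpa using hle 1 (one_mem _)
  choose u hu hmem hlen using hmin
  have hinj' : Function.Injective fun i => w i * u i := by
    intro i j hij
    apply hinj
    have := congrArg (cs.weight hsl s) hij
    simpa only [weight_mul_of_mem_parabolic cs hsl hs (hu _)] using this
  rw [growth, ← Nat.card_eq_fintype_card, ← Set.ncard_range_of_injective hinj']
  refine Set.ncard_le_ncard ?_ (cs.growth_set_finite _ _)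
  rintro _ ⟨i, rfl⟩
  exact ⟨hmem i, (hlen i).trans (hk i)⟩

omit [Fintype B] [DecidableEq B] in
theorem hasExponentialGrowth_of_two_pow_le_growth {F : Set W} {L : ℕ} (hL : 0 < L)
    (h : ∀ k, 2 ^ k ≤ cs.growth F (L * (k + 1))) : cs.HasExponentialGrowth F := by
  have hLpos : (0 : ℝ) < 1 / (2 * L) := by positivity
  refine lt_of_lt_of_le (b := (2 : ℝ≥0∞) ^ (1 / (2 * (L : ℝ)))) ?_ ?_
  · exact ENNReal.one_lt_rpow (by norm_num) hLpos
  · refine le_limsup_of_frequently_le' ?_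
    rw [frequently_atTop]
    intro a
    -- Using a + 1 letters rather than a keeps the exponent (a + 1) / (L (a + 2)) at least 1 / (2L),
    -- even for a = 0.
    refine ⟨L * (a + 1 + 1), by nlinarith, ?_⟩
    have h1 : ((2 : ℝ≥0∞) ^ (a + 1)) ≤ (cs.growth F (L * (a + 1 + 1)) : ℝ≥0∞) := by
      exact_mod_cast h (a + 1)
    refine le_trans ?_ (ENNReal.rpow_le_rpow h1 (by positivity))
    rw [← ENNReal.rpow_natCast, ← ENNReal.rpow_mul]
    refine ENNReal.rpow_le_rpow_of_exponent_le (by norm_num) ?_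
    have hL' : (0 : ℝ) < L := by exact_mod_cast hL
    push_cast
    rw [mul_one_div, div_le_div_iff₀ (by positivity) (by positivity)]
    nlinarith [(Nat.cast_nonneg a : (0 : ℝ) ≤ a)]

/-- The words without repetition in three elements `R 0`, `R 1`, `R 2`, as products, each together
with its leftmost letter. -/
def alternatingProd (R : Fin 3 → W) (a : Fin 3) : List Bool → W × Fin 3
  | [] => (R a, a)
  | b :: l =>
    let p := alternatingProd R a l
    -- Adding 1 or 2 modulo 3 selects one of the two letters other than the previous one.
    let c := p.2 + if b then 1 else 2
    (R c * p.1, c)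

omit [Fintype B] [DecidableEq B] in
theorem length_alternatingProd_le {L : ℕ} {R : Fin 3 → W} (hR : ∀ a, cs.length (R a) ≤ L)
    (a : Fin 3) (l : List Bool) :
    cs.length (alternatingProd R a l).1 ≤ L * (l.length + 1) := by
  induction l with
  | nil => simpa [alternatingProd] using hR a
  | cons b l ih =>
    refine (cs.length_mul_le _ _).trans ?_
    rw [List.length_cons, mul_add_one L (l.length + 1), add_comm]
    exact add_le_add ih (hR _)

/-- Three roots with pairwise products at most `-2` generate a free product of three groups of
order two, whose alternating words move the fundamental weight to distinct places. -/
theorem hasExponentialGrowth_of_three_roots {s : B} {J : Set B} (hs : s ∉ J) (r : Fin 3 → B → ℤ)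
    (hr : ∀ a, r a ∈ cs.roots hsl) (hneg : ∀ a b, a ≠ b → M.form (r a) (r b) ≤ -2)
    (h0 : ∀ a, 0 ≤ r a s) (hpos : ∃ a, 0 < r a s) :
    cs.HasExponentialGrowth (cs.minCosetReps J) := by
  have hR : ∀ a, ∃ g : W, cs.rootAction hsl g = M.reflectionMap (r a) ∧ g⁻¹ = g := by
    intro a
    obtain ⟨w, i, hw⟩ := hr a
    exact ⟨w * cs.simple i * w⁻¹, by rw [rootAction_conj, hw], by simp [mul_assoc]⟩
  choose R hR hRinv using hR
  obtain ⟨a₀, ha₀⟩ := hpos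
  let x (w : W) (b : Fin 3) : ℤ := cs.weight hsl s w (r b)
  have hx (a : Fin 3) (w : W) (b : Fin 3) : x (R a * w) b = x w b - M.form (r b) (r a) * x w a := by
    simp only [x, weight_mul, hRinv, hR, reflectionMap_apply]
    simp only [weight, map_sub, map_smul, Pi.sub_apply, Pi.smul_apply, smul_eq_mul]
  have hself (a : Fin 3) : M.form (r a) (r a) = 2 := form_self_of_mem_roots (hr a)
  -- Ping-pong invariant: the weight is negative on the root of the leftmost letter, and on the
  -- other two at least as large in absolute value and positive. A new letter c negates x c and adds
  -- at least 2 x c to the other values.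
  have hstate (l : List Bool) : x (alternatingProd R a₀ l).1 (alternatingProd R a₀ l).2 < 0 ∧
      ∀ b ≠ (alternatingProd R a₀ l).2, - x (alternatingProd R a₀ l).1 (alternatingProd R a₀ l).2 ≤
        x (alternatingProd R a₀ l).1 b := by
    induction l with
    | nil =>
      have hx1 (b : Fin 3) : x (R a₀) b = r b s - M.form (r b) (r a₀) * r a₀ s := by
        have := hx a₀ 1 b
        simpa [x, weight] using this
      simp only [alternatingProd, hx1, hself]
      refine ⟨by linarith, fun b hb => ?_⟩
      nlinarith [hneg b a₀ hb, h0 b]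
    | cons b l ih =>
      generalize hp : alternatingProd R a₀ l = p at ih
      have hc : p.2 + (if b then 1 else 2) ≠ p.2 := by
        rw [Ne, add_eq_left]
        cases b <;> simp
      simp only [alternatingProd, hp, hx, hself]
      generalize p.2 + (if b then 1 else 2) = c at hc
      obtain ⟨hlt, hle⟩ := ih
      have hcpos := hle c hc
      refine ⟨by linarith, fun d hd => ?_⟩
      by_cases hdp : d = p.2
      · subst hdp
        nlinarith [hneg _ c hd]
      · nlinarith [hneg d c hd, hle d hdp]
  have hlast (l l' : List Bool)
      (h : cs.weight hsl s (alternatingProd R a₀ l).1 = cs.weight hsl s (alternatingProd R a₀ l').1) :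
      (alternatingProd R a₀ l).2 = (alternatingProd R a₀ l').2 := by
    by_contra hne
    have h1 := hstate l
    have h2 := (hstate l').2 _ hne
    have h3 := (hstate l').1
    simp only [x, ← h] at h1 h2 h3
    omega
  have hinj (k : ℕ) (l l' : List Bool) (hl : l.length = k) (hl' : l'.length = k)
      (h : cs.weight hsl s (alternatingProd R a₀ l).1 =
        cs.weight hsl s (alternatingProd R a₀ l').1) : l = l' := by
    induction k generalizing l l' with
    | zero => rw [List.length_eq_zero_iff.1 hl, List.length_eq_zero_iff.1 hl']
    | succ k ih =>
      obtain ⟨b, t, rfl⟩ := List.exists_cons_of_length_eq_add_one hl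
      obtain ⟨b', t', rfl⟩ := List.exists_cons_of_length_eq_add_one hl'
      have hc := hlast _ _ h
      -- The common leftmost reflection can be cancelled.
      have ht : t = t' := by
        refine ih t t' (by simpa using hl) (by simpa using hl') ?_
        funext v
        simp only [alternatingProd] at h hc
        rw [← hc] at h
        generalize (alternatingProd R a₀ t).2 + (if b then 1 else 2) = c at h
        have := congrFun h (cs.rootAction hsl (R c) v)
        simpa only [weight_mul, rootAction_inv_apply] using this
      subst ht
      simp only [alternatingProd, add_right_inj] at hc
      cases b <;> cases b' <;> simp_all
  have hlen (a : Fin 3) : cs.length (R a) ≤ 1 + ∑ a, cs.length (R a) :=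
    (Finset.single_le_sum (f := fun a => cs.length (R a)) (fun _ _ => Nat.zero_le _)
      (Finset.mem_univ a)).trans (Nat.le_add_left _ _)
  refine cs.hasExponentialGrowth_of_two_pow_le_growth (L := 1 + ∑ a, cs.length (R a))
    (by omega) fun k => ?_
  have := cs.card_le_growth_minCosetReps hsl (J := J) hs (ι := List.Vector Bool k)
    (fun l => (alternatingProd R a₀ l.1).1)
    (fun l => by simpa using cs.length_alternatingProd_le hlen a₀ l.1)
    fun l l' h => Subtype.ext (hinj k _ _ l.2 l'.2 h)
  simpa [card_vector] using this

end CoxeterSystem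

/-! ### The Gram matrix and uniqueness of the invariant form -/

namespace CoxeterMatrix

variable {B : Type*} [Fintype B] [DecidableEq B] {M : CoxeterMatrix B}

omit [Fintype B] in
theorem IsSimplyLaced.gram_apply (hsl : M.IsSimplyLaced) (i j : B) :
    M.gram i j = (M.cartan i j : ℝ) / 2 := by
  by_cases h : i = j
  · subst h
    simp [gram, cartan_self]
  · rcases hsl i j h with h' | h'
    · simp [gram, M.cartan_of_eq_two h', h']
    · simp only [gram, M.cartan_of_eq_three h', h', Matrix.of_apply, Nat.cast_ofNat,
        Real.cos_pi_div_three]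
      norm_num

theorem form_pos_of_posDef_gram (hsl : M.IsSimplyLaced) (hpd : M.gram.PosDef) {v : B → ℤ}
    (hv : v ≠ 0) : 0 < M.form v v := by
  have hv' : (fun i => (v i : ℝ)) ≠ 0 := by
    contrapose! hv
    funext i
    simpa using congrFun hv i
  have h := hpd.dotProduct_mulVec_pos hv'
  have h2 : star (fun i => (v i : ℝ)) ⬝ᵥ M.gram.mulVec (fun i => (v i : ℝ)) =
      (M.form v v : ℝ) / 2 := by
    rw [form_apply]
    push_cast
    simp only [dotProduct, Matrix.mulVec, hsl.gram_apply, Finset.mul_sum, Finset.sum_div]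
    refine Finset.sum_congr rfl fun i _ => Finset.sum_congr rfl fun j _ => ?_
    simp only [Pi.star_apply, star_trivial]
    ring
  rw [h2] at h
  have : (0 : ℝ) < M.form v v := by linarith
  exact_mod_cast this

theorem form_reflectionMap_left (r u v : B → ℤ) :
    M.form (M.reflectionMap r u) v = M.form u v - M.form u r * M.form r v := by
  rw [reflectionMap_apply, map_sub, LinearMap.sub_apply, LinearMap.map_smul₂, smul_eq_mul]

theorem form_eq_sum_mul (u v : B → ℤ) : M.form u v = ∑ i, v i * M.form u (simpleRoot i) := by
  rw [form_apply, Finset.sum_comm]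
  refine Finset.sum_congr rfl fun i _ => ?_
  rw [form_simpleRoot_right, Finset.mul_sum]
  exact Finset.sum_congr rfl fun j _ => by ring

omit [Fintype B] in
/-- For a finite set `F` of integral functionals stable under the reflections of an irreducible
Weyl group, the invariant positive semidefinite form `∑ f ⊗ f` is a multiple of the Cartan
matrix. -/
theorem exists_mul_cartan_eq_sum (hirr : M.IsIrreducible) (F : Finset (B → ℤ))
    (hF : ∀ f ∈ F, ∀ k, (fun i => f i - f k * M.cartan k i) ∈ F) :
    ∃ c : ℤ, ∀ i j, c * M.cartan i j = 2 * ∑ f ∈ F, f i * f j := by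
  have hkey (k j : B) : M.cartan k j * ∑ f ∈ F, f k * f k = 2 * ∑ f ∈ F, f k * f j := by
    have hinv (f : B → ℤ) (i : B) : f i - f k * M.cartan k i -
        (f k - f k * M.cartan k k) * M.cartan k i = f i := by
      rw [cartan_self]; ring
    -- Reindexing by the k-th reflection, an involution of `F` that sends f k to -f k.
    have hsum : ∑ f ∈ F, f k * f j =
        ∑ f ∈ F, (f k - f k * M.cartan k k) * (f j - f k * M.cartan k j) :=
      Finset.sum_nbij' (fun f i => f i - f k * M.cartan k i) (fun f i => f i - f k * M.cartan k i)
        (fun f hf => hF f hf k) (fun f hf => hF f hf k) (fun f _ => funext (hinv f))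
        (fun f _ => funext (hinv f)) fun f _ => by rw [hinv, hinv]
    rw [two_mul]
    nth_rw 1 [hsum]
    rw [Finset.mul_sum, ← Finset.sum_add_distrib]
    refine Finset.sum_congr rfl fun f _ => ?_
    rw [cartan_self]; ring
  obtain ⟨i₀⟩ := hirr.nonempty
  have hconst (i : B) : ∑ f ∈ F, f i * f i = ∑ f ∈ F, f i₀ * f i₀ := by
    obtain ⟨p⟩ := hirr.preconnected i i₀
    induction p with
    | nil => rfl
    | @cons u v w h p ih =>
      rw [← ih]
      have h1 := hkey u v
      have h2 := hkey v u
      rw [(M.cartan_eq_neg_one_iff _ _).2 h] at h1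
      rw [(M.cartan_eq_neg_one_iff _ _).2 h.symm] at h2
      have h3 : ∑ f ∈ F, f v * f u = ∑ f ∈ F, f u * f v :=
        Finset.sum_congr rfl fun f _ => mul_comm _ _
      linarith
  exact ⟨∑ f ∈ F, f i₀ * f i₀, fun i j => by rw [← hconst i, ← hkey, mul_comm]⟩

end CoxeterMatrix

/-! ### Finding three roots with very negative products -/

namespace CoxeterSystem

open CoxeterMatrix

variable {B : Type*} [Fintype B] [DecidableEq B] {W : Type*} [Group W] {M : CoxeterMatrix B}
  {cs : CoxeterSystem M W} {hsl : M.IsSimplyLaced}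

theorem finite_form_image_of_bounded
    (h : ∀ r ∈ cs.roots hsl, ∀ i, |M.form r (simpleRoot i)| ≤ 2) :
    ((fun r i => M.form r (simpleRoot i)) '' cs.roots hsl).Finite := by
  refine (Set.finite_Icc (fun _ : B => (-2 : ℤ)) fun _ => 2).subset ?_
  rintro _ ⟨r, hr, rfl⟩
  exact ⟨fun i => (abs_le.1 (h r hr i)).1, fun i => (abs_le.1 (h r hr i)).2⟩

/-- If the products of roots are bounded by `2`, then the canonical form is positive
semidefinite. -/
theorem posSemidef_gram_of_bounded (hirr : M.IsIrreducible)
    (h : ∀ r ∈ cs.roots hsl, ∀ i, |M.form r (simpleRoot i)| ≤ 2) : M.gram.PosSemidef := by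
  have hfin := finite_form_image_of_bounded h
  obtain ⟨c, hc⟩ := exists_mul_cartan_eq_sum hirr hfin.toFinset <| by
    intro f hf k
    rw [Set.Finite.mem_toFinset] at hf ⊢
    obtain ⟨r, hr, rfl⟩ := hf
    refine ⟨_, reflectionMap_mem_roots hr k, funext fun i => ?_⟩
    beta_reduce
    rw [form_reflectionMap_left, form_simpleRoot_simpleRoot]
  have hcpos : 0 < c := by
    obtain ⟨i⟩ := hirr.nonempty
    have h1 := hc i i
    rw [cartan_self] at h1
    have h2 : 0 < ∑ f ∈ hfin.toFinset, f i * f i := by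
      refine Finset.sum_pos' (fun f _ => mul_self_nonneg _) ⟨_, hfin.mem_toFinset.2
        ⟨_, simpleRoot_mem_roots i, rfl⟩, ?_⟩
      simp [form_simpleRoot_self]
    omega
  have hgram : M.gram = ∑ f ∈ hfin.toFinset,
      (1 / (c : ℝ)) • Matrix.vecMulVec (fun i => (f i : ℝ)) (star fun i => (f i : ℝ)) := by
    ext i j
    have hcR : (c : ℝ) ≠ 0 := by exact_mod_cast hcpos.ne'
    have hij : (c : ℝ) * M.cartan i j = 2 * ∑ f ∈ hfin.toFinset, (f i : ℝ) * f j := by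
      exact_mod_cast hc i j
    rw [hsl.gram_apply, Matrix.sum_apply]
    simp only [Matrix.smul_apply, Matrix.vecMulVec_apply, star_trivial, smul_eq_mul,
      ← Finset.mul_sum]
    field_simp
    linarith
  rw [hgram]
  refine Matrix.posSemidef_sum _ fun f _ => (Matrix.posSemidef_vecMulVec_self_star _).smul ?_
  have : (0 : ℝ) < c := by exact_mod_cast hcpos
  positivity

/-- A simply laced Coxeter group with positive definite canonical form is finite. -/
theorem finite_of_posDef_gram (cs : CoxeterSystem M W) (hsl : M.IsSimplyLaced) (hpd : M.gram.PosDef) : Finite W := by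
  have hnn (v : B → ℤ) : 0 ≤ M.form v v := by
    by_cases hv : v = 0
    · simp [hv]
    · exact (form_pos_of_posDef_gram hsl hpd hv).le
  have hfin := finite_form_image_of_bounded (cs := cs) (hsl := hsl) <| by
    intro r hr i
    -- Nonnegativity of the norms of r ± α_i, namely 4 ± 2 (r, α_i), bounds the product by 2.
    have h1 := hnn (r + simpleRoot i)
    have h2 := hnn (r - simpleRoot i)
    have h3 := form_self_of_mem_roots hr
    have h4 := M.form_simpleRoot_self i
    simp only [map_add, map_sub, LinearMap.add_apply, LinearMap.sub_apply, h3, h4,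
      M.form_symm (simpleRoot i) r] at h1 h2
    rw [abs_le]
    constructor <;> linarith
  have hroots : (cs.roots hsl).Finite := by
    refine Set.Finite.of_finite_image hfin fun u _ v _ huv => ?_
    by_contra hne
    have := form_pos_of_posDef_gram hsl hpd (sub_ne_zero.2 hne)
    rw [form_eq_sum_mul] at this
    refine this.ne' (Finset.sum_eq_zero fun i _ => ?_)
    have hi : M.form u (simpleRoot i) = M.form v (simpleRoot i) := congrFun huv i
    simp [hi]
  have := hroots.to_subtype
  refine Finite.of_injective (β := B → cs.roots hsl)
    (fun w i => ⟨_, rootAction_mem_roots (simpleRoot_mem_roots i) w⟩) fun u w huw => ?_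
  refine cs.rootAction_injective hsl (LinearMap.pi_ext fun i x => ?_)
  have hi := Subtype.ext_iff.1 (congrFun huw i)
  simp only at hi
  have hx : (Pi.single i x : B → ℤ) = x • simpleRoot i := by simp [simpleRoot, ← Pi.single_smul]
  rw [hx, map_smul, map_smul, hi]

theorem exists_root_form_le_neg_three (cs : CoxeterSystem M W) (hirr : M.IsIrreducible) (hinf : Infinite W)
    (haff : ¬ M.IsAffine) (hsl : M.IsSimplyLaced) :
    ∃ r ∈ cs.roots hsl, 0 ≤ r ∧ ∃ i, M.form r (simpleRoot i) ≤ -3 := by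
  obtain ⟨r, hr, i, hri⟩ : ∃ r ∈ cs.roots hsl, ∃ i, 2 < |M.form r (simpleRoot i)| := by
    by_contra! h
    have hpd : M.gram.PosDef := by
      by_contra hpd
      exact haff ⟨hirr, posSemidef_gram_of_bounded hirr h, hpd⟩
    exact not_finite_iff_infinite.2 hinf (cs.finite_of_posDef_gram hsl hpd)
  obtain ⟨r, hr, h0, hri⟩ : ∃ r ∈ cs.roots hsl, 0 ≤ r ∧ 2 < |M.form r (simpleRoot i)| := by
    rcases nonneg_or_nonpos_of_mem_roots hr with h | h
    · exact ⟨r, hr, h, hri⟩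
    · exact ⟨-r, neg_mem_roots hr, neg_nonneg.2 h, by simpa using hri⟩
  -- If the product is at least 3, reflecting in α_i flips its sign and keeps the root positive.
  rcases lt_abs.1 hri with h | h
  · refine ⟨_, reflectionMap_mem_roots hr i, reflectionMap_nonneg hr h0 ?_, i, ?_⟩
    · rintro rfl
      rw [form_simpleRoot_self] at h
      omega
    · rw [form_reflectionMap_left, form_simpleRoot_self]
      omega
  · exact ⟨r, hr, h0, i, by omega⟩

/-- A positive root `r` and a simple root with product at most `-3` yield three positive roots with
pairwise products at most `-2`: conjugates of `r` under the parabolic subgroup of type `A₂` generated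
by the given node and a neighbour. -/
theorem exists_three_roots {r : B → ℤ} (hr : r ∈ cs.roots hsl) (h0 : 0 ≤ r) {i : B}
    (hri : M.form r (simpleRoot i) ≤ -3) :
    ∃ t : Fin 3 → B → ℤ, (∀ a, t a ∈ cs.roots hsl ∧ 0 ≤ t a) ∧
      ∀ a b, a ≠ b → M.form (t a) (t b) ≤ -2 := by
  -- Without a neighbour of `i`, a nonnegative r would have nonnegative product with α_i.
  obtain ⟨j, hj⟩ : ∃ j, M.cartan j i = -1 := by
    by_contra! h
    have : 0 ≤ M.form r (simpleRoot i) := by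
      rw [form_simpleRoot_right]
      refine Finset.sum_nonneg fun j _ => mul_nonneg (h0 j) ?_
      by_cases hji : j = i
      · simp [hji, cartan_self]
      · rw [M.cartan_eq_zero hji]
        rw [← cartan_eq_neg_one_iff]
        exact h j
    omega
  have hself := form_self_of_mem_roots hr
  have hii := M.form_simpleRoot_self i
  have hji := M.form_simpleRoot_simpleRoot j i
  have hij := M.form_symm (simpleRoot j) (simpleRoot i)
  rw [hj] at hji
  have hne (k : B) (v : B → ℤ) (hv : v ∈ cs.roots hsl) (h : M.form v (simpleRoot i) ≠ 2 ∧
      M.form v (simpleRoot i) ≠ -1) (hk : k = i ∨ k = j) : v ≠ simpleRoot k := by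
    rintro rfl
    rcases hk with rfl | rfl <;> omega
  have hi_mem := reflectionMap_mem_roots hr i
  have hj_mem := reflectionMap_mem_roots hr j
  have hi0 := reflectionMap_nonneg hr h0 (hne i r hr (by omega) (.inl rfl))
  have hj0 := reflectionMap_nonneg hr h0 (hne j r hr (by omega) (.inr rfl))
  have hsymm (a b : B → ℤ) (h : M.form a b ≤ -2) : M.form b a ≤ -2 := by rwa [form_symm]
  have hri' := M.form_symm r (simpleRoot i)
  have triple (u v w : B → ℤ) (hu : u ∈ cs.roots hsl ∧ 0 ≤ u) (hv : v ∈ cs.roots hsl ∧ 0 ≤ v)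
      (hw : w ∈ cs.roots hsl ∧ 0 ≤ w) (huv : M.form u v ≤ -2) (huw : M.form u w ≤ -2)
      (hvw : M.form v w ≤ -2) : ∃ t : Fin 3 → B → ℤ, (∀ a, t a ∈ cs.roots hsl ∧ 0 ≤ t a) ∧
        ∀ a b, a ≠ b → M.form (t a) (t b) ≤ -2 := by
    refine ⟨![u, v, w], fun a => ?_, fun a b hab => ?_⟩
    · fin_cases a <;> assumption
    · fin_cases a <;> fin_cases b <;> first | exact absurd rfl hab | assumption |
        exact hsymm _ _ ‹_›
  generalize hp : M.form r (simpleRoot i) = p at *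
  generalize hq : M.form r (simpleRoot j) = q at *
  -- For |q| ≥ 2 take r, s_i r, s_j r, with products 2 - p², 2 - q², 2 - p² - pq - q². Otherwise
  -- take r, s_i r, s_j s_i r, where 2 - (p + q)² replaces 2 - q² and p + q ≤ -2.
  by_cases hq2 : q ≤ -2 ∨ 2 ≤ q
  · refine triple r _ _ ⟨hr, h0⟩ ⟨hi_mem, hi0⟩ ⟨hj_mem, hj0⟩ ?_ ?_ ?_ <;>
      simp only [reflectionMap_apply, map_sub, map_smul, LinearMap.sub_apply, LinearMap.smul_apply,
        smul_eq_mul, hp, hq, hself, ← hri', hji, ← hij]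
    · nlinarith
    · rcases hq2 with h | h <;> nlinarith
    · nlinarith [sq_nonneg (p + 2 * q)]
  · have hq3 : q = -1 ∨ q = 0 ∨ q = 1 := by omega
    have hij_mem := reflectionMap_mem_roots hi_mem j
    have hij0 := reflectionMap_nonneg hi_mem hi0 (i := j) (by
      refine hne j _ hi_mem ?_ (.inr rfl)
      simp only [reflectionMap_apply, map_sub, map_smul, LinearMap.sub_apply, LinearMap.smul_apply,
        smul_eq_mul, hp, hii]
      omega)
    refine triple r _ _ ⟨hr, h0⟩ ⟨hi_mem, hi0⟩ ⟨hij_mem, hij0⟩ ?_ ?_ ?_ <;>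
      simp only [reflectionMap_apply, map_sub, map_smul, LinearMap.sub_apply, LinearMap.smul_apply,
        smul_eq_mul, hp, hq, hself, ← hri', hii, hji, ← hij]
    · nlinarith
    · rcases hq3 with rfl | rfl | rfl <;> nlinarith
    · rcases hq3 with rfl | rfl | rfl <;> nlinarith

/-- By irreducibility, a family of nonnegative vectors, not all zero, can be moved by one group
element to a family of nonnegative vectors, one of which is positive at a given node. -/
theorem exists_rootAction_pos (hirr : M.IsIrreducible) (s : B) {ι : Type*} (t : ι → B → ℤ)
    (h0 : ∀ a, 0 ≤ t a) (hne : ∃ a, t a ≠ 0) :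
    ∃ w : W, (∀ a, 0 ≤ cs.rootAction hsl w (t a)) ∧ ∃ a, 0 < cs.rootAction hsl w (t a) s := by
  classical
  induction hn : (Finset.univ.filter fun j => ∀ a, t a j = 0).card using Nat.strong_induction_on
    generalizing t with
  | _ n ih =>
  subst hn
  by_cases hs : ∀ a, t a s = 0
  · obtain ⟨a, ha⟩ := hne
    obtain ⟨k, hk⟩ := Function.ne_iff.1 ha
    obtain ⟨p⟩ := hirr.preconnected k s
    -- An edge from i in the joint support to j outside it: reflecting in α_j makes coordinate j the
    -- sum of the neighbouring ones, which enlarges the support.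
    obtain ⟨d, -, hd1, hd2⟩ := p.exists_boundary_dart {j | ∃ a, t a j ≠ 0} ⟨a, hk⟩ (by simpa using hs)
    obtain ⟨⟨i, j⟩, hadj⟩ := d
    simp only [Set.mem_ofPred_eq, not_exists, not_not] at hd1 hd2
    obtain ⟨b, hb⟩ := hd1
    have hval (a : ι) : M.reflectionMap (simpleRoot j) (t a) j = ∑ k, t a k * -M.cartan k j := by
      rw [reflectionMap_apply, Pi.sub_apply, hd2 a, form_simpleRoot_right]
      simp
    have hterm (a : ι) (k : B) : 0 ≤ t a k * -M.cartan k j := by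
      by_cases hkj : k = j
      · simp [hkj, hd2 a]
      · exact mul_nonneg (h0 a k) (neg_nonneg.2 (M.cartan_nonpos hkj))
    have hpos : 0 < M.reflectionMap (simpleRoot j) (t b) j := by
      rw [hval]
      refine Finset.sum_pos' (fun k _ => hterm b k) ⟨i, Finset.mem_univ _, ?_⟩
      rw [(M.cartan_eq_neg_one_iff i j).2 hadj]
      have := h0 b i
      simp only [Pi.zero_apply] at this
      omega
    have hnonneg (a : ι) : 0 ≤ M.reflectionMap (simpleRoot j) (t a) := by
      intro k
      by_cases hkj : k = j
      · subst hkj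
        rw [hval]
        exact Finset.sum_nonneg fun k _ => hterm a k
      · rw [M.reflectionMap_simpleRoot_apply_of_ne hkj]
        exact h0 a k
    have hlt : (Finset.univ.filter fun k => ∀ a, M.reflectionMap (simpleRoot j) (t a) k = 0).card <
        (Finset.univ.filter fun k => ∀ a, t a k = 0).card := by
      refine Finset.card_lt_card ((Finset.ssubset_iff_of_subset fun k hk => ?_).2 ⟨j, ?_, ?_⟩)
      · simp only [Finset.mem_filter, Finset.mem_univ, true_and] at hk ⊢
        by_cases hkj : k = j
        · exact hkj ▸ hd2
        · intro a
          rw [← M.reflectionMap_simpleRoot_apply_of_ne hkj (t a)]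
          exact hk a
      · simpa using hd2
      · simpa using ⟨b, hpos.ne'⟩
    obtain ⟨w, hw0, c, hc⟩ := ih _ hlt (fun a => M.reflectionMap (simpleRoot j) (t a)) hnonneg
      ⟨b, fun h => hpos.ne' (congrFun h j)⟩ rfl
    refine ⟨w * cs.simple j, fun a => ?_, c, ?_⟩
    · rw [rootAction_mul_apply, rootAction_simple]
      exact hw0 a
    · rw [rootAction_mul_apply, rootAction_simple]
      exact hc
  · push Not at hs
    obtain ⟨a, ha⟩ := hs
    exact ⟨1, by simpa using h0, a, by simpa using lt_of_le_of_ne (h0 a s) ha.symm⟩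

end CoxeterSystem

end

theorem theorem2p3 {B : Type*} [Finite B] {W : Type*} [Group W] {M : CoxeterMatrix B}
    (cs : CoxeterSystem M W)
    (hirr : M.IsIrreducible)
    (hinf : Infinite W)
    (haff : ¬ M.IsAffine)
    (hsl : M.IsSimplyLaced)
    (J : Set B) (hJ : J ⊂ Set.univ) :
    cs.HasExponentialGrowth (cs.minCosetReps J) := by
  classical
  have := Fintype.ofFinite B
  obtain ⟨s, -, hs⟩ := Set.exists_of_ssubset hJ
  obtain ⟨r, hr, h0, i, hri⟩ := cs.exists_root_form_le_neg_three hirr hinf haff hsl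
  obtain ⟨t, ht, hneg⟩ := CoxeterSystem.exists_three_roots hr h0 hri
  have hne : t 0 ≠ 0 := by
    intro h
    have := CoxeterSystem.form_self_of_mem_roots (ht 0).1
    simp [h] at this
  obtain ⟨w, hw0, hw⟩ :=
    CoxeterSystem.exists_rootAction_pos (cs := cs) (hsl := hsl) hirr s t (fun a => (ht a).2) ⟨0, hne⟩
  refine cs.hasExponentialGrowth_of_three_roots hsl hs (fun a => cs.rootAction hsl w (t a))
    (fun a => CoxeterSystem.rootAction_mem_roots (ht a).1 w) (fun a b hab => ?_)
    (fun a => hw0 a s) hw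
  rw [CoxeterSystem.form_rootAction]
  exact hneg a b hab
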